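/- Let $X$ be a finite-dimensional real or complex inner product space, with inner product conjugate-linear in the left entry, and extend it to the exterior algebra $\bigwedge X$ by $\langle v_1\wedge\cdots\wedge v_p, w_1\wedge\cdots\wedge w_p\rangle=\det(\langle v_i,w_j\rangle)$, with elements of distinct grades orthogonal; $\|M\|=\sqrt{\langle M,M\rangle}$. The contractions $M\lrcorner N$ and $N\llcorner M$ are the unique elements with $\langle L,M\lrcorner N\rangle=\langle M\wedge L,N\rangle$ and $\langle L,N\llcorner M\rangle=\langle L\wedge M,N\rangle$ for all $L\in\bigwedge X$. A $p$-blade is a product $v_1\wedge\cdots\wedge v_p$ of vectors (any scalar, if $p=0$); the space of a nonzero one is $[v_1\wedge\cdots\wedge v_p]=\mathrm{span}(v_1,\dots,v_p)$ ($\{0\}$ for a scalar). For a nonzero blade $B$, $P_B$ is the algebra homomorphism of $\bigwedge X$ extending the orthogonal projection $X\to[B]$. A multivector has the orientation of $B$ if it equals $kB$ with $k>0$ real. Let $A\in\bigwedge^pX$ and $B\in\bigwedge^qX$ be nonzero blades and $m=\min\{p,q\}$. Take orthonormal bases $(e_1,\dots,e_p)$ of $[A]$ and $(f_1,\dots,f_q)$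 of $[B]$ with $\langle e_i,f_j\rangle=0$ for $i\ne j$ and $\langle e_1,f_1\rangle\ge\cdots\ge\langle e_m,f_m\rangle\ge0$, write $B=B_P\wedge B_\perp$ with $B_P=\epsilon\|B\|f_1\wedge\cdots\wedge f_m$, $|\epsilon|=1$, $B_\perp=f_{m+1}\wedge\cdots\wedge f_q$, and let $\Theta_{[A],[B]}=\arccos\frac{|\langle A,B_P\rangle|}{\|A\|\|B\|}$ (this does not depend on the choices). Then $A$ is partially orthogonal to $B$, i.e. $[A]\cap[B]^\perp\neq\{0\}$, if and only if $A\lrcorner B=0$ and $B\llcorner A=0$. Otherwise $p\le q$ and $\|A\|\|B\|\cos\Theta_{[A],[B]}=\|P_BA\|\|B\|$; moreover $A\lrcorner B$ is the unique $(q-p)$-blade $C$ such that (i) $[C]=[A]^\perp\cap[B]$, (ii) $\|C\|=\|A\|\|B\|\cos\Theta_{[A],[B]}$, (iii) $(P_BA)\wedge C$ has the orientation of $B$; and $B\llcorner A$ is the unique $(q-p)$-blade $C$ satisfying (i), (ii) and (iii') $C\wedge(P_BA)$ has the orientation of $B$. -/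

import Mathlib

open scoped ComplexConjugate InnerProductSpace

namespace Grassmann

noncomputable section

variable {𝕜 X : Type*} [RCLike 𝕜] [NormedAddCommGroup X] [InnerProductSpace 𝕜 X]

/-- For fixed `w₁, …, w_p`, the alternating map `(v₁, …, v_p) ↦ det ⟪w i, v j⟫`. -/
def gramForm {p : ℕ} (w : Fin p → X) : X [⋀^Fin p]→ₗ[𝕜] 𝕜 :=
  Matrix.detRowAlternating.compLinearMap (LinearMap.pi fun i => innerₛₗ 𝕜 (w i))

theorem gramForm_apply {p : ℕ} (w v : Fin p → X) :
    gramForm (𝕜 := 𝕜) w v = (Matrix.of fun i j => ⟪w i, v j⟫_𝕜).det := by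
  rw [← Matrix.det_transpose]
  rfl

/-- The linear functional `⟪w₁ ∧ ⋯ ∧ w_p, ·⟫` on `⋀X`: it is `det ⟪w i, v j⟫` on
`v₁ ∧ ⋯ ∧ v_p`, and zero on the components of grade different from `p`. -/
def bladeFunctional {p : ℕ} (w : Fin p → X) : ExteriorAlgebra 𝕜 X →ₗ[𝕜] 𝕜 :=
  ExteriorAlgebra.liftAlternating (Pi.single p (gramForm w))

theorem bladeFunctional_update_add {p : ℕ} (w : Fin p → X) (i : Fin p) (x y : X) :
    bladeFunctional (𝕜 := 𝕜) (Function.update w i (x + y)) =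
      bladeFunctional (Function.update w i x) + bladeFunctional (Function.update w i y) := by
  have h : gramForm (𝕜 := 𝕜) (Function.update w i (x + y)) =
      gramForm (Function.update w i x) + gramForm (Function.update w i y) := by
    ext v
    have key : ∀ z : X, (Matrix.of fun a b => ⟪Function.update w i z a, v b⟫_𝕜) =
        (Matrix.of fun a b => ⟪w a, v b⟫_𝕜).updateRow i (fun b => ⟪z, v b⟫_𝕜) := by
      intro z
      ext a b
      by_cases hai : a = i
      · subst hai; simp
      · simp [hai]
    rw [AlternatingMap.add_apply, gramForm_apply, gramForm_apply, gramForm_apply, key, key, key,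
      ← Matrix.det_updateRow_add]
    congr 2
    ext b
    simp [inner_add_left]
  rw [bladeFunctional, h, Pi.single_add, map_add]
  rfl

theorem bladeFunctional_update_smul {p : ℕ} (w : Fin p → X) (i : Fin p) (c : 𝕜) (x : X) :
    bladeFunctional (𝕜 := 𝕜) (Function.update w i (c • x)) =
      conj c • bladeFunctional (Function.update w i x) := by
  have h : gramForm (𝕜 := 𝕜) (Function.update w i (c • x)) =
      conj c • gramForm (Function.update w i x) := by
    ext v
    have key : ∀ z : X, (Matrix.of fun a b => ⟪Function.update w i z a, v b⟫_𝕜) =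
        (Matrix.of fun a b => ⟪w a, v b⟫_𝕜).updateRow i (fun b => ⟪z, v b⟫_𝕜) := by
      intro z
      ext a b
      by_cases hai : a = i
      · subst hai; simp
      · simp [hai]
    rw [AlternatingMap.smul_apply, gramForm_apply, gramForm_apply, key, key, smul_eq_mul,
      ← Matrix.det_updateRow_smul]
    congr 2
    ext b
    simp [inner_smul_left]
  rw [bladeFunctional, h, Pi.single_smul, map_smul]
  rfl

theorem bladeFunctional_eq_zero {p : ℕ} (w : Fin p → X) (i j : Fin p) (hw : w i = w j)
    (hij : i ≠ j) : bladeFunctional (𝕜 := 𝕜) w = 0 := by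
  have h : gramForm (𝕜 := 𝕜) w = 0 := by
    ext v
    rw [gramForm_apply]
    exact Matrix.det_zero_of_row_eq hij (by ext b; simp [hw])
  rw [bladeFunctional, h, Pi.single_zero, map_zero]

/-- The linear functional `M ↦ conj ⟪M, N⟫` on `⋀X`. -/
def conjInner (N : ExteriorAlgebra 𝕜 X) : ExteriorAlgebra 𝕜 X →ₗ[𝕜] 𝕜 :=
  ExteriorAlgebra.liftAlternating fun p =>
    { toFun := fun w : Fin p → X => conj (bladeFunctional (𝕜 := 𝕜) w N)
      map_update_add' := by
        intro inst w i x y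
        obtain rfl := Subsingleton.elim inst (instDecidableEqFin p)
        rw [bladeFunctional_update_add, LinearMap.add_apply, map_add]
      map_update_smul' := by
        intro inst w i c x
        obtain rfl := Subsingleton.elim inst (instDecidableEqFin p)
        rw [bladeFunctional_update_smul, LinearMap.smul_apply, smul_eq_mul, map_mul,
          RCLike.conj_conj, smul_eq_mul]
      map_eq_zero_of_eq' := by
        intro w i j hw hij
        rw [bladeFunctional_eq_zero w i j hw hij, LinearMap.zero_apply, map_zero] }

/-- The inner product of multivectors, conjugate-linear in the left entry: it is
`det ⟪v i, w j⟫` for blades `v₁ ∧ ⋯ ∧ v_p`, `w₁ ∧ ⋯ ∧ w_p` of the same grade, and zero for blades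
of distinct grades (see `mvInner_ιMulti` and `mvInner_ιMulti_of_ne`). -/
def mvInner (M N : ExteriorAlgebra 𝕜 X) : 𝕜 := conj (conjInner N M)

theorem mvInner_ιMulti_left {p : ℕ} (v : Fin p → X) (N : ExteriorAlgebra 𝕜 X) :
    mvInner (ExteriorAlgebra.ιMulti 𝕜 p v) N = bladeFunctional v N := by
  rw [mvInner, conjInner, ExteriorAlgebra.liftAlternating_apply_ιMulti]
  exact RCLike.conj_conj _

theorem mvInner_ιMulti {p : ℕ} (v w : Fin p → X) :
    mvInner (ExteriorAlgebra.ιMulti 𝕜 p v) (ExteriorAlgebra.ιMulti 𝕜 p w) =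
      (Matrix.of fun i j => ⟪v i, w j⟫_𝕜).det := by
  rw [mvInner_ιMulti_left, bladeFunctional, ExteriorAlgebra.liftAlternating_apply_ιMulti,
    Pi.single_eq_same, gramForm_apply]

theorem mvInner_ιMulti_of_ne {p q : ℕ} (hpq : p ≠ q) (v : Fin p → X) (w : Fin q → X) :
    mvInner (ExteriorAlgebra.ιMulti 𝕜 p v) (ExteriorAlgebra.ιMulti 𝕜 q w) = 0 := by
  rw [mvInner_ιMulti_left, bladeFunctional, ExteriorAlgebra.liftAlternating_apply_ιMulti,
    Pi.single_eq_of_ne hpq.symm]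
  rfl

theorem mvInner_add_left (M M' N : ExteriorAlgebra 𝕜 X) :
    mvInner (M + M') N = mvInner M N + mvInner M' N := by
  simp [mvInner]

theorem mvInner_smul_left (c : 𝕜) (M N : ExteriorAlgebra 𝕜 X) :
    mvInner (c • M) N = conj c * mvInner M N := by
  simp [mvInner]

theorem mvInner_left_ext {N N' N'' : ExteriorAlgebra 𝕜 X} (c : 𝕜)
    (h : ∀ (p : ℕ) (v : Fin p → X), mvInner (ExteriorAlgebra.ιMulti 𝕜 p v) N =
      mvInner (ExteriorAlgebra.ιMulti 𝕜 p v) N' + c * mvInner (ExteriorAlgebra.ιMulti 𝕜 p v) N'')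
    (M : ExteriorAlgebra 𝕜 X) : mvInner M N = mvInner M N' + c * mvInner M N'' := by
  have hM : M ∈ Submodule.span 𝕜
      (Set.range fun x : Σ n, (Fin n → X) => ExteriorAlgebra.ιMulti 𝕜 x.1 x.2) := by
    rw [ExteriorAlgebra.ιMulti_span]; trivial
  induction hM using Submodule.span_induction with
  | mem x hx => obtain ⟨⟨p, v⟩, rfl⟩ := hx; exact h p v
  | zero => simp [mvInner]
  | add x y _ _ hx hy => simp only [mvInner_add_left, hx, hy]; ring
  | smul a x _ hx => simp only [mvInner_smul_left, hx]; ring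

theorem mvInner_add_right (M N N' : ExteriorAlgebra 𝕜 X) :
    mvInner M (N + N') = mvInner M N + mvInner M N' := by
  have := mvInner_left_ext (N := N + N') (N' := N) (N'' := N') 1
    (fun p v => by simp [mvInner_ιMulti_left]) M
  simpa using this

theorem mvInner_smul_right (c : 𝕜) (M N : ExteriorAlgebra 𝕜 X) :
    mvInner M (c • N) = c * mvInner M N := by
  have := mvInner_left_ext (N := c • N) (N' := 0) (N'' := N) c
    (fun p v => by simp [mvInner_ιMulti_left]) M
  have h0 : mvInner M (0 : ExteriorAlgebra 𝕜 X) = 0 := by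
    have := mvInner_add_right M (0 : ExteriorAlgebra 𝕜 X) 0
    simpa using this
  simpa [h0] using this

/-- The inner product of multivectors as a sesquilinear map. -/
def mvInnerₛₗ : ExteriorAlgebra 𝕜 X →ₗ⋆[𝕜] ExteriorAlgebra 𝕜 X →ₗ[𝕜] 𝕜 :=
  LinearMap.mk₂'ₛₗ (starRingEnd 𝕜) (RingHom.id 𝕜) mvInner mvInner_add_left
    (fun c M N => by simp [mvInner_smul_left]) mvInner_add_right
    (fun c M N => by simp [mvInner_smul_right])

theorem mvInner_basis {n : ℕ} (b : OrthonormalBasis (Fin n) 𝕜 X) (s t : Finset (Fin n)) :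
    mvInner (b.toBasis.ExteriorAlgebra s) (b.toBasis.ExteriorAlgebra t) =
      if s = t then 1 else 0 := by
  rw [ExteriorAlgebra.basis_apply, ExteriorAlgebra.basis_apply]
  by_cases hc : s.card = t.card
  · rw [← ExteriorAlgebra.basis_apply b.toBasis t, ExteriorAlgebra.basis_apply_ofCard b.toBasis hc.symm]
    rw [mvInner_ιMulti]
    split_ifs with h
    · subst h
      convert Matrix.det_one (n := Fin s.card)
      ext i j
      simp [Matrix.one_apply, orthonormal_iff_ite.mp b.orthonormal]
    · have : (Set.powersetCard.ofCard hc.symm) ≠ (Set.powersetCard.ofCard rfl : Set.powersetCard _ s.card) := by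
        intro h'; exact h (congrArg Subtype.val h').symm
      obtain ⟨x, hxt, hxs⟩ := (Set.powersetCard.exists_mem_notMem_iff_ne _ _).mp this
      simp only [Set.mem_range, not_exists,
        ← Set.powersetCard.mem_range_ofFinEmbEquiv_symm_iff_mem] at hxs hxt
      obtain ⟨i, rfl⟩ := hxt
      refine Matrix.det_eq_zero_of_column_eq_zero i fun j => ?_
      simpa using b.orthonormal.inner_eq_zero (hxs j)
  · rw [if_neg (by rintro rfl; exact hc rfl)]
    exact mvInner_ιMulti_of_ne hc _ _

theorem mvInner_basis_left {n : ℕ} (b : OrthonormalBasis (Fin n) 𝕜 X) (s : Finset (Fin n))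
    (C : ExteriorAlgebra 𝕜 X) :
    mvInner (b.toBasis.ExteriorAlgebra s) C = b.toBasis.ExteriorAlgebra.repr C s := by
  have h : mvInnerₛₗ (b.toBasis.ExteriorAlgebra s) = b.toBasis.ExteriorAlgebra.coord s := by
    refine b.toBasis.ExteriorAlgebra.ext fun t => ?_
    change mvInner _ _ = _
    rw [mvInner_basis, Module.Basis.coord_apply, Module.Basis.repr_self, Finsupp.single_apply]
    simp only [eq_comm]
  exact LinearMap.congr_fun h C

/-- Riesz representation for the inner product of multivectors. -/
theorem existsUnique_mvInner_eq [FiniteDimensional 𝕜 X] (ψ : ExteriorAlgebra 𝕜 X →ₗ⋆[𝕜] 𝕜) :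
    ∃! C : ExteriorAlgebra 𝕜 X, ∀ L, mvInner L C = ψ L := by
  let b := stdOrthonormalBasis 𝕜 X
  refine ⟨∑ s, ψ (b.toBasis.ExteriorAlgebra s) • b.toBasis.ExteriorAlgebra s, fun L => ?_,
    fun C hC => ?_⟩
  · have h : mvInnerₛₗ.flip (∑ s, ψ (b.toBasis.ExteriorAlgebra s) • b.toBasis.ExteriorAlgebra s)
        = ψ := by
      refine b.toBasis.ExteriorAlgebra.ext fun t => ?_
      change mvInner _ _ = _
      rw [mvInner_basis_left, Module.Basis.repr_sum_self]
    exact LinearMap.congr_fun h L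
  · refine b.toBasis.ExteriorAlgebra.ext_elem fun s => ?_
    rw [← mvInner_basis_left, hC, Module.Basis.repr_sum_self]

theorem existsUnique_leftContraction [FiniteDimensional 𝕜 X] (M N : ExteriorAlgebra 𝕜 X) :
    ∃! C : ExteriorAlgebra 𝕜 X, ∀ L, mvInner L C = mvInner (M * L) N :=
  existsUnique_mvInner_eq ((mvInnerₛₗ.flip N).comp (LinearMap.mulLeft 𝕜 M))

theorem existsUnique_rightContraction [FiniteDimensional 𝕜 X] (N M : ExteriorAlgebra 𝕜 X) :
    ∃! C : ExteriorAlgebra 𝕜 X, ∀ L, mvInner L C = mvInner (L * M) N :=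
  existsUnique_mvInner_eq ((mvInnerₛₗ.flip N).comp (LinearMap.mulRight 𝕜 M))

/-- The left contraction `M ⌋ N` of the contractor `M` on the contractee `N`: the unique
multivector with `⟪L, M ⌋ N⟫ = ⟪M ∧ L, N⟫` for all `L`. -/
def leftContraction [FiniteDimensional 𝕜 X] (M N : ExteriorAlgebra 𝕜 X) : ExteriorAlgebra 𝕜 X :=
  (existsUnique_leftContraction M N).choose

/-- The right contraction `N ⌊ M` of the contractee `N` by the contractor `M`: the unique
multivector with `⟪L, N ⌊ M⟫ = ⟪L ∧ M, N⟫` for all `L`. -/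
def rightContraction [FiniteDimensional 𝕜 X] (N M : ExteriorAlgebra 𝕜 X) : ExteriorAlgebra 𝕜 X :=
  (existsUnique_rightContraction N M).choose

/-- The norm `‖M‖ = √⟪M, M⟫` of a multivector. -/
def mvNorm (M : ExteriorAlgebra 𝕜 X) : ℝ := √(RCLike.re (mvInner M M))

/-- `B` is a `p`-blade. The scalar factor `c` is redundant for `p ≥ 1`; for `p = 0` it makes every
scalar a `0`-blade. -/
def IsBlade (p : ℕ) (B : ExteriorAlgebra 𝕜 X) : Prop :=
  ∃ (c : 𝕜) (v : Fin p → X), B = c • ExteriorAlgebra.ιMulti 𝕜 p v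

/-- The space `[B]` of a nonzero blade `B`: the span of the vectors `v₁, …, v_p` in any
factorization `B = c • v₁ ∧ ⋯ ∧ v_p`. All factorizations of a nonzero blade have the same span
(see `bladeSpace_eq_span`), so the infimum is over a one-element set. -/
def bladeSpace (B : ExteriorAlgebra 𝕜 X) : Submodule 𝕜 X :=
  sInf {V | ∃ (p : ℕ) (c : 𝕜) (v : Fin p → X),
    B = c • ExteriorAlgebra.ιMulti 𝕜 p v ∧ V = Submodule.span 𝕜 (Set.range v)}

theorem mem_span_iff_ι_mul_eq_zero {p : ℕ} {v : Fin p → X}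
    (hv : ExteriorAlgebra.ιMulti 𝕜 p v ≠ 0) (x : X) :
    x ∈ Submodule.span 𝕜 (Set.range v) ↔
      ExteriorAlgebra.ι 𝕜 x * ExteriorAlgebra.ιMulti 𝕜 p v = 0 := by
  have hcons : ExteriorAlgebra.ι 𝕜 x * ExteriorAlgebra.ιMulti 𝕜 p v =
      ExteriorAlgebra.ιMulti 𝕜 (p + 1) (Fin.cons x v) := by
    rw [ExteriorAlgebra.ιMulti_succ_apply]
    simp [Matrix.vecTail, Function.comp_def]
  have hind : LinearIndependent 𝕜 v := by
    by_contra h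
    exact hv (AlternatingMap.map_linearDependent _ v h)
  rw [hcons]
  constructor
  · intro hx
    refine AlternatingMap.map_linearDependent _ _ fun h => ?_
    exact (linearIndependent_finCons.mp h).2 hx
  · intro h0
    by_contra hx
    have hli := linearIndependent_finCons.mpr ⟨hind, hx⟩
    have h1 := (exteriorPower.ιMulti_family_linearIndependent_field (n := p + 1) hli).ne_zero
      (Set.powersetCard.ofCard (Finset.card_fin (p + 1)))
    apply h1
    apply Subtype.ext
    rw [exteriorPower.ιMulti_family_apply_coe]
    have hid : ⇑(Set.powersetCard.ofFinEmbEquiv.symm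
        (Set.powersetCard.ofCard (Finset.card_fin (p + 1)))) = (id : Fin (p + 1) → Fin (p + 1)) := by
      rw [Set.powersetCard.ofFinEmbEquiv_symm_apply]
      exact (Finset.orderEmbOfFin_unique _ (fun _ => Finset.mem_univ _) strictMono_id).symm
    rw [ExteriorAlgebra.ιMulti_family, hid]
    exact h0

/-- The space of a nonzero blade is the span of the vectors in any of its factorizations. -/
theorem bladeSpace_eq_span {p : ℕ} {c : 𝕜} {v : Fin p → X}
    (h : c • ExteriorAlgebra.ιMulti 𝕜 p v ≠ 0) :
    bladeSpace (c • ExteriorAlgebra.ιMulti 𝕜 p v) = Submodule.span 𝕜 (Set.range v) := by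
  refine le_antisymm (sInf_le ⟨p, c, v, rfl, rfl⟩) (le_sInf ?_)
  rintro V ⟨q, d, w, hw, rfl⟩ x hx
  have hd : d ≠ 0 ∧ ExteriorAlgebra.ιMulti 𝕜 q w ≠ 0 := by
    rw [hw] at h; exact smul_ne_zero_iff.mp h
  rw [mem_span_iff_ι_mul_eq_zero (smul_ne_zero_iff.mp h).2] at hx
  rw [mem_span_iff_ι_mul_eq_zero hd.2]
  have : d • (ExteriorAlgebra.ι 𝕜 x * ExteriorAlgebra.ιMulti 𝕜 q w) = 0 := by
    rw [← mul_smul_comm, ← hw, mul_smul_comm, hx, smul_zero]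
  exact (smul_eq_zero.mp this).resolve_left hd.1

/-- `A` and `B` have the same orientation: `A = k B` with `k > 0` real, also over `ℂ`. -/
def SameOrientation (A B : ExteriorAlgebra 𝕜 X) : Prop :=
  ∃ k : ℝ, 0 < k ∧ A = (k : 𝕜) • B

/-- The subspace `V` is partially orthogonal to the subspace `W`. -/
def PartiallyOrthogonal (V W : Submodule 𝕜 X) : Prop := V ⊓ Wᗮ ≠ ⊥

/-- The extension to `⋀X` of the orthogonal projection of `X` onto `V`, with `1 ↦ 1` and
`v₁ ∧ ⋯ ∧ v_p ↦ P v₁ ∧ ⋯ ∧ P v_p`. -/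
def mvProj [FiniteDimensional 𝕜 X] (V : Submodule 𝕜 X) :
    ExteriorAlgebra 𝕜 X →ₐ[𝕜] ExteriorAlgebra 𝕜 X :=
  ExteriorAlgebra.map (V.starProjection : X →ₗ[𝕜] X)

/-- The `k`-th angle between the families `e` and `f`, for `k < min p q`. -/
def pairAngle (𝕜 : Type*) {X : Type*} [RCLike 𝕜] [NormedAddCommGroup X] [InnerProductSpace 𝕜 X]
    {p q : ℕ} (e : Fin p → X) (f : Fin q → X) (k : Fin (min p q)) : ℝ :=
  Real.arccos (RCLike.re
    ⟪e (Fin.castLE (min_le_left p q) k), f (Fin.castLE (min_le_right p q) k)⟫_𝕜)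

/-- `e` and `f` are associated principal bases of the subspaces `V` and `W`. If `V` or `W` is zero
this says only that `e` and `f` are orthonormal bases of `V` and `W`. -/
structure IsPrincipalBases {p q : ℕ} (V W : Submodule 𝕜 X) (e : Fin p → X) (f : Fin q → X) :
    Prop where
  orthonormal_left : Orthonormal 𝕜 e
  span_left : Submodule.span 𝕜 (Set.range e) = V
  orthonormal_right : Orthonormal 𝕜 f
  span_right : Submodule.span 𝕜 (Set.range f) = W
  inner_eq_zero : ∀ (i : Fin p) (j : Fin q), (i : ℕ) ≠ j → ⟪e i, f j⟫_𝕜 = 0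
  inner_nonneg : ∀ (i : Fin p) (j : Fin q), (i : ℕ) = j →
    0 ≤ RCLike.re ⟪e i, f j⟫_𝕜 ∧ RCLike.im ⟪e i, f j⟫_𝕜 = 0
  monotone_angle : Monotone (pairAngle 𝕜 e f)

/-- `B = P ∧ Q` is a projective-orthogonal factorization of the nonzero blade `B` with respect to
the nonzero blade `A`: for a principal basis `f₁, …, f_q` of `[B]` with respect to `[A]`,
`m = min p q` and a unit scalar `ε`, one has `P = ε ‖B‖ f₁ ∧ ⋯ ∧ f_m` and
`Q = f_{m+1} ∧ ⋯ ∧ f_q`. -/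
def IsPOFactorization (A B P Q : ExteriorAlgebra 𝕜 X) : Prop :=
  ∃ (p q : ℕ) (e : Fin p → X) (f : Fin q → X) (ε : 𝕜),
    IsPrincipalBases (bladeSpace A) (bladeSpace B) e f ∧ ‖ε‖ = 1 ∧
    P = (ε * (mvNorm B : 𝕜)) •
      ExteriorAlgebra.ιMulti 𝕜 (min p q) (fun i => f (Fin.castLE (min_le_right p q) i)) ∧
    Q = ExteriorAlgebra.ιMulti 𝕜 (q - min p q)
      (fun i => f ⟨min p q + i, by have := i.isLt; omega⟩) ∧
    B = P * Q

open Classical in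
/-- The asymmetric angle `Θ_{[A],[B]} = arccos (|⟪A, B_P⟫| / (‖A‖ ‖B‖))` of `[A]` with `[B]`, for
nonzero blades `A` and `B` and a projective-orthogonal factorization `B = B_P ∧ B_⊥` with respect
to `A` (one exists, and the angle does not depend on its choice). -/
def asymmetricAngle (A B : ExteriorAlgebra 𝕜 X) : ℝ :=
  if h : ∃ P Q, IsPOFactorization A B P Q then
    Real.arccos (‖mvInner A h.choose‖ / (mvNorm A * mvNorm B))
  else 0

end

end Grassmann

open Grassmann

/-! ### Norms, spaces and commutation of blades -/

namespace Grassmann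

open ExteriorAlgebra Module

variable {𝕜 X : Type*} [RCLike 𝕜] [NormedAddCommGroup X] [InnerProductSpace 𝕜 X]

/-! Everything becomes explicit in principal bases. When `p ≤ q`, the singular value decomposition
of the orthogonal projection `[A] → [B]` gives orthonormal bases `e`, `f` with `⟪e i, f j⟫` zero off
the diagonal and real nonnegative on it (`exists_isPrincipalBases`). Write `A = c e₁ ∧ ⋯ ∧ e_p`, `B
= d f₁ ∧ ⋯ ∧ f_q`, and let `κ` be the product of the diagonal cosines. Then `P_B A = c κ f₁ ∧ ⋯ ∧
f_p`, `cos Θ = κ` and `A ⌋ B = conj c d κ f_{p+1} ∧ ⋯ ∧ f_q`, the last because a Gram determinant is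
block triangular.

Partial orthogonality means `κ = 0`. If `κ ≠ 0`, the vectors `f_{p+1}, …, f_q` span `[A]ᗮ ⊓ [B]`,
and `(P_B A) ∧ (A ⌋ B) = |c|² κ² B`; this gives (i)–(iii). For uniqueness, blades of equal space are
proportional, the orientation makes the ratio positive and the norm makes it 1. The right
contraction differs from the left one by the sign `(-1)^(p(q-p))`, the same sign that exchanges
(iii) and (iii'). If `q < p`, the contractions vanish by grade and a dimension count gives partial
orthogonality. -/

theorem mvInner_zero_right (M : ExteriorAlgebra 𝕜 X) : mvInner M (0 : ExteriorAlgebra 𝕜 X) = 0 :=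
  map_zero (mvInnerₛₗ M)

theorem mvNorm_smul (c : 𝕜) (M : ExteriorAlgebra 𝕜 X) : mvNorm (c • M) = ‖c‖ * mvNorm M := by
  have h : RCLike.re (mvInner (c • M) (c • M)) = ‖c‖ ^ 2 * RCLike.re (mvInner M M) := by
    rw [mvInner_smul_left, mvInner_smul_right, ← mul_assoc, RCLike.conj_mul, ← RCLike.ofReal_pow,
      RCLike.re_ofReal_mul]
  rw [mvNorm, h, Real.sqrt_mul (sq_nonneg _), Real.sqrt_sq (norm_nonneg _), mvNorm]

theorem mvNorm_ιMulti_of_orthonormal {p : ℕ} {e : Fin p → X} (he : Orthonormal 𝕜 e) :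
    mvNorm (ιMulti 𝕜 p e) = 1 := by
  have h : (Matrix.of fun i j => ⟪e i, e j⟫_𝕜) = 1 := by
    ext i j
    simp [Matrix.one_apply, orthonormal_iff_ite.mp he]
  rw [mvNorm, mvInner_ιMulti, h]
  simp

theorem ιMulti_ne_zero_of_orthonormal {p : ℕ} {e : Fin p → X} (he : Orthonormal 𝕜 e) :
    ιMulti 𝕜 p e ≠ 0 := by
  intro h
  have := mvNorm_ιMulti_of_orthonormal he
  simp [h, mvNorm, mvInner_zero_right] at this

theorem linearIndependent_of_ιMulti_ne_zero {p : ℕ} {v : Fin p → X} (hv : ιMulti 𝕜 p v ≠ 0) :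
    LinearIndependent 𝕜 v := by
  by_contra h
  exact hv (AlternatingMap.map_linearDependent _ v h)

theorem IsBlade.finrank_bladeSpace {p : ℕ} {A : ExteriorAlgebra 𝕜 X} (hA : IsBlade p A)
    (hA0 : A ≠ 0) : finrank 𝕜 (bladeSpace A) = p := by
  obtain ⟨c, v, rfl⟩ := hA
  rw [bladeSpace_eq_span hA0, finrank_span_eq_card
    (linearIndependent_of_ιMulti_ne_zero (smul_ne_zero_iff.mp hA0).2), Fintype.card_fin]

/-- A wedge product of `p` vectors in the span of `p` linearly independent vectors is a multiple of
the wedge product of the latter. -/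
theorem exists_ιMulti_eq_smul {p : ℕ} {v w : Fin p → X} (hw : LinearIndependent 𝕜 w)
    (h : ∀ i, v i ∈ Submodule.span 𝕜 (Set.range w)) :
    ∃ c : 𝕜, ιMulti 𝕜 p v = c • ιMulti 𝕜 p w := by
  classical
  let b := Basis.span hw
  have hb : ∀ i, (b i : X) = w i := fun i => congrArg Subtype.val (Basis.span_apply hw i)
  let V := Submodule.span 𝕜 (Set.range w)
  -- Alternating `p`-forms on a space of dimension `p` are determined by their value on a basis, so
  -- the wedge product restricted to the span is a determinant times its value on `w`.
  have key : (ιMulti 𝕜 p).compLinearMap V.subtype =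
      (LinearMap.toSpanSingleton 𝕜 _ (ιMulti 𝕜 p w)).compAlternatingMap b.det := by
    refine Basis.ext_alternating b fun σ hσ => ?_
    let τ : Equiv.Perm (Fin p) := Equiv.ofBijective σ (Finite.injective_iff_bijective.mp hσ)
    have h1 : (fun i => b (σ i)) = b ∘ τ := rfl
    rw [h1, AlternatingMap.map_perm, AlternatingMap.map_perm]
    congr 1
    simp [Basis.det_self, hb, V]
  refine ⟨b.det fun i => ⟨v i, h i⟩, ?_⟩
  exact DFunLike.congr_fun key fun i => ⟨v i, h i⟩

theorem IsBlade.exists_eq_smul_ιMulti {p : ℕ} {A : ExteriorAlgebra 𝕜 X} (hA : IsBlade p A)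
    (hA0 : A ≠ 0) {w : Fin p → X} (hw : LinearIndependent 𝕜 w)
    (h : bladeSpace A = Submodule.span 𝕜 (Set.range w)) : ∃ c : 𝕜, A = c • ιMulti 𝕜 p w := by
  obtain ⟨c, v, rfl⟩ := hA
  rw [bladeSpace_eq_span hA0] at h
  obtain ⟨d, hd⟩ := exists_ιMulti_eq_smul hw
    fun i => h ▸ Submodule.subset_span (Set.mem_range_self i)
  exact ⟨c * d, by rw [hd, smul_smul]⟩

theorem ιMulti_cast {m n : ℕ} (h : m = n) (v : Fin n → X) :
    ιMulti 𝕜 m (fun i => v (Fin.cast h i)) = ιMulti 𝕜 n v := by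
  subst h
  rfl

theorem ι_mul_ιMulti_comm {r : ℕ} (x : X) (v : Fin r → X) :
    ι 𝕜 x * ιMulti 𝕜 r v = (-1 : 𝕜) ^ r • (ιMulti 𝕜 r v * ι 𝕜 x) := by
  induction r with
  | zero => simp
  | succ r ih =>
    have h : ι 𝕜 x * ι 𝕜 (v 0) = -(ι 𝕜 (v 0) * ι 𝕜 x) :=
      eq_neg_of_add_eq_zero_left (ι_add_mul_swap x (v 0))
    rw [ιMulti_succ_apply, ← mul_assoc, h, neg_mul, mul_assoc, ih, pow_succ]
    simp [mul_assoc]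

theorem ιMulti_mul_ιMulti_comm {p r : ℕ} (e : Fin p → X) (v : Fin r → X) :
    ιMulti 𝕜 p e * ιMulti 𝕜 r v = (-1 : 𝕜) ^ (p * r) • (ιMulti 𝕜 r v * ιMulti 𝕜 p e) := by
  induction p with
  | zero => simp
  | succ p ih =>
    rw [ιMulti_succ_apply, mul_assoc, ih, mul_smul_comm, ← mul_assoc, ι_mul_ιMulti_comm,
      smul_mul_assoc, smul_smul, mul_assoc, ← pow_add]
    ring_nf

theorem IsBlade.mul_comm {p r : ℕ} {A C : ExteriorAlgebra 𝕜 X} (hA : IsBlade p A)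
    (hC : IsBlade r C) : A * C = (-1 : 𝕜) ^ (p * r) • (C * A) := by
  obtain ⟨c, v, rfl⟩ := hA
  obtain ⟨d, w, rfl⟩ := hC
  rw [smul_mul_smul_comm, smul_mul_smul_comm, ιMulti_mul_ιMulti_comm, smul_comm, _root_.mul_comm c]

theorem IsBlade.smul {p : ℕ} {A : ExteriorAlgebra 𝕜 X} (hA : IsBlade p A) (c : 𝕜) :
    IsBlade p (c • A) := by
  obtain ⟨d, v, rfl⟩ := hA
  exact ⟨c * d, v, smul_smul _ _ _⟩

theorem bladeSpace_smul {p : ℕ} {A : ExteriorAlgebra 𝕜 X} (hA : IsBlade p A) (hA0 : A ≠ 0)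
    {c : 𝕜} (hc : c ≠ 0) : bladeSpace (c • A) = bladeSpace A := by
  obtain ⟨d, v, rfl⟩ := hA
  rw [bladeSpace_eq_span hA0, smul_smul, bladeSpace_eq_span]
  rw [← smul_smul]
  exact smul_ne_zero hc hA0

theorem mvInner_eq_zero_of_ne {p q : ℕ} (hpq : p ≠ q) {A B : ExteriorAlgebra 𝕜 X}
    (hA : IsBlade p A) (hB : IsBlade q B) : mvInner A B = 0 := by
  obtain ⟨c, v, rfl⟩ := hA
  obtain ⟨d, w, rfl⟩ := hB
  rw [mvInner_smul_left, mvInner_smul_right, mvInner_ιMulti_of_ne hpq, mul_zero, mul_zero]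

theorem IsBlade.mul {p q : ℕ} {A B : ExteriorAlgebra 𝕜 X} (hA : IsBlade p A) (hB : IsBlade q B) :
    IsBlade (p + q) (A * B) := by
  obtain ⟨c, v, rfl⟩ := hA
  obtain ⟨d, w, rfl⟩ := hB
  exact ⟨c * d, Fin.append v w, by rw [smul_mul_smul_comm, ιMulti_mul_ιMulti]⟩

/-! ### Contractions of blades -/

section Contraction

variable [FiniteDimensional 𝕜 X]

theorem mvInner_leftContraction (L M N : ExteriorAlgebra 𝕜 X) :
    mvInner L (leftContraction M N) = mvInner (M * L) N :=
  (existsUnique_leftContraction M N).choose_spec.1 L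

theorem mvInner_rightContraction (L M N : ExteriorAlgebra 𝕜 X) :
    mvInner L (rightContraction N M) = mvInner (L * M) N :=
  (existsUnique_rightContraction N M).choose_spec.1 L

/-- Wedge products span the exterior algebra, so the defining identity need only be tested on them.
-/
theorem eq_leftContraction {M N C : ExteriorAlgebra 𝕜 X}
    (h : ∀ (r : ℕ) (v : Fin r → X), mvInner (ιMulti 𝕜 r v) C = mvInner (M * ιMulti 𝕜 r v) N) :
    C = leftContraction M N := by
  refine (existsUnique_leftContraction M N).choose_spec.2 C fun L => ?_
  rw [← mvInner_leftContraction]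
  simpa using mvInner_left_ext (N'' := 0) 0
    (fun r v => by rw [h, ← mvInner_leftContraction]; simp) L

/-- For blades, the contractions agree up to the grade-commutation sign. -/
theorem rightContraction_eq_smul_leftContraction {p q : ℕ} {A B : ExteriorAlgebra 𝕜 X}
    (hA : IsBlade p A) (hB : IsBlade q B) :
    rightContraction B A = (-1 : 𝕜) ^ (p * (q - p)) • leftContraction A B := by
  have hs : ((-1 : 𝕜) ^ (p * (q - p))) * (-1 : 𝕜) ^ (p * (q - p)) = 1 := by
    rw [← mul_pow]; simp
  -- Only test blades of grade `r` with `p + r = q` pair nontrivially. If `q < p` there are none, so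
  -- the truncated subtraction in the exponent does no harm.
  have key : (-1 : 𝕜) ^ (p * (q - p)) • rightContraction B A = leftContraction A B := by
    refine eq_leftContraction fun r v => ?_
    have hv : IsBlade r (ιMulti 𝕜 r v) := ⟨1, v, (one_smul _ _).symm⟩
    rw [mvInner_smul_right, mvInner_rightContraction]
    by_cases hr : p + r = q
    · subst hr
      rw [hA.mul_comm hv, Nat.add_sub_cancel_left, mvInner_smul_left]
      simp
    · rw [mvInner_eq_zero_of_ne hr (hA.mul hv) hB,
        mvInner_eq_zero_of_ne (by omega) (hv.mul hA) hB, mul_zero]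
  rw [← key, smul_smul, hs, one_smul]

theorem leftContraction_eq_zero_of_lt {p q : ℕ} (hpq : q < p) {A B : ExteriorAlgebra 𝕜 X}
    (hA : IsBlade p A) (hB : IsBlade q B) : leftContraction A B = 0 := by
  symm
  refine eq_leftContraction fun r v => ?_
  rw [mvInner_zero_right, mvInner_eq_zero_of_ne (by omega) (hA.mul ⟨1, v, (one_smul _ _).symm⟩) hB]

/-- The contraction of wedge products whose factors are biorthogonal. -/
theorem leftContraction_ιMulti {p r : ℕ} {e g : Fin p → X} {h : Fin r → X} {σ : Fin p → ℝ}
    (hg : ∀ i j, ⟪e i, g j⟫_𝕜 = if i = j then (σ i : 𝕜) else 0) (hh : ∀ i j, ⟪e i, h j⟫_𝕜 = 0) :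
    leftContraction (ιMulti 𝕜 p e) (ιMulti 𝕜 (p + r) (Fin.append g h)) =
      (∏ i, (σ i : 𝕜)) • ιMulti 𝕜 r h := by
  symm
  refine eq_leftContraction fun s v => ?_
  rw [mvInner_smul_right, ιMulti_mul_ιMulti]
  by_cases hs : s = r
  · subst hs
    rw [mvInner_ιMulti, mvInner_ιMulti, ← Matrix.det_reindex_self (finSumFinEquiv (m := p)).symm]
    -- The upper right block vanishes because `e` is orthogonal to `h`. The determinant therefore
    -- ignores the block pairing `v` with `g`.
    have : Matrix.reindex (finSumFinEquiv (m := p) (n := s)).symm finSumFinEquiv.symm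
        (Matrix.of fun i j => ⟪Fin.append e v i, Fin.append g h j⟫_𝕜) =
        Matrix.fromBlocks (Matrix.diagonal fun i => (σ i : 𝕜)) 0
          (Matrix.of fun i j => ⟪v i, g j⟫_𝕜) (Matrix.of fun i j => ⟪v i, h j⟫_𝕜) := by
      ext (i | i) (j | j) <;> simp [hg, hh, Matrix.diagonal_apply]
    rw [this, Matrix.det_fromBlocks_zero₁₂, Matrix.det_diagonal]
  · rw [mvInner_ιMulti_of_ne hs, mvInner_ιMulti_of_ne (by omega), mul_zero]

end Contraction

end Grassmann

/-! ### Existence of principal bases -/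

namespace Grassmann

open ExteriorAlgebra Module

variable {𝕜 X : Type*} [RCLike 𝕜] [NormedAddCommGroup X] [InnerProductSpace 𝕜 X]

/-- Principal bases exist for subspaces of dimensions `p ≤ q`: take eigenvectors of the
composition of the projections between the subspaces. -/
theorem exists_isPrincipalBases [FiniteDimensional 𝕜 X] {p q : ℕ} (hpq : p ≤ q)
    {V W : Submodule 𝕜 X} (hV : finrank 𝕜 V = p) (hW : finrank 𝕜 W = q) :
    ∃ (e : Fin p → X) (f : Fin q → X), IsPrincipalBases V W e f := by
  -- Eigenvectors of `S* S` form the principal basis of `V`; their images under `S` are mutually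
  -- orthogonal, with squared norms the eigenvalues.
  let S : V →ₗ[𝕜] W := (W.orthogonalProjectionOnto : X →ₗ[𝕜] W) ∘ₗ V.subtype
  have hS : ∀ (x : V) (y : W), ⟪(x : X), (y : X)⟫_𝕜 = ⟪S x, y⟫_𝕜 := fun x y =>
    (Submodule.inner_orthogonalProjectionOnto_eq_of_mem_right y (x : X)).symm
  have hT : (S.adjoint ∘ₗ S).IsSymmetric := S.isPositive_adjoint_comp_self.isSymmetric
  let b := hT.eigenvectorBasis hV
  let l := hT.eigenvalues hV
  have hSb : ∀ i j, ⟪S (b i), S (b j)⟫_𝕜 = if i = j then (l j : 𝕜) else 0 := by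
    intro i j
    have h1 : (S.adjoint ∘ₗ S) (b j) = (l j : 𝕜) • b j := hT.apply_eigenvectorBasis hV j
    rw [← LinearMap.adjoint_inner_right, ← LinearMap.comp_apply, h1, inner_smul_right,
      orthonormal_iff_ite.mp b.orthonormal]
    split_ifs <;> simp
  have hl : ∀ i, ‖S (b i)‖ ^ 2 = l i := by
    intro i
    have := hSb i i
    rw [if_pos rfl, inner_self_eq_norm_sq_to_K] at this
    exact_mod_cast this
  -- Normalized images of the eigenvectors. The value 0 past index `p` is a filler: only indices in
  -- `s`, where the image is nonzero, are kept when extending to an orthonormal basis of `W`.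
  let u : Fin q → W := fun j => if h : (j : ℕ) < p then
    ((‖S (b ⟨j, h⟩)‖⁻¹ : ℝ) : 𝕜) • S (b ⟨j, h⟩) else 0
  let s : Set (Fin q) := {j | ∃ h : (j : ℕ) < p, S (b ⟨j, h⟩) ≠ 0}
  have hu : Orthonormal 𝕜 (s.domRestrict u) := by
    rw [orthonormal_iff_ite]
    rintro ⟨i, hi, hi0⟩ ⟨j, hj, hj0⟩
    simp only [Set.domRestrict_apply, u, dif_pos hi, dif_pos hj, inner_smul_left,
      inner_smul_right, hSb, Subtype.mk.injEq, Fin.ext_iff]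
    split_ifs with hij
    · obtain rfl : i = j := Fin.ext hij
      rw [← hl, RCLike.conj_ofReal]
      have := norm_ne_zero_iff.mpr hi0
      norm_cast
      field_simp
    · simp
  obtain ⟨f, hf⟩ := hu.exists_orthonormalBasis_extension_of_card_eq (by simp [hW])
  have hSf : ∀ (i : Fin p) (j : Fin q), (i : ℕ) = j → S (b i) = ((‖S (b i)‖ : ℝ) : 𝕜) • f j := by
    intro i j hij
    by_cases h0 : S (b i) = 0
    · simp [h0]
    have hj : (j : ℕ) < p := hij ▸ i.isLt
    obtain rfl : i = ⟨j, hj⟩ := Fin.ext hij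
    rw [hf j ⟨hj, h0⟩]
    simp only [u, dif_pos hj, smul_smul]
    have := norm_ne_zero_iff.mpr h0
    rw [← RCLike.ofReal_mul, mul_inv_cancel₀ this]
    simp
  have hin : ∀ (i : Fin p) (j : Fin q), (i : ℕ) = j →
      ⟪(b i : X), (f j : X)⟫_𝕜 = ((‖S (b i)‖ : ℝ) : 𝕜) := by
    intro i j hij
    rw [hS]
    conv_lhs => rw [hSf i j hij]
    rw [inner_smul_left, orthonormal_iff_ite.mp f.orthonormal]
    simp
  have hspan : ∀ {n : ℕ} (U : Submodule 𝕜 X) (c : OrthonormalBasis (Fin n) 𝕜 U),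
      Submodule.span 𝕜 (Set.range fun i => (c i : X)) = U := by
    intro n U c
    have := congrArg (Submodule.map U.subtype) c.toBasis.span_eq
    rw [Submodule.map_span, ← Set.range_comp, Submodule.map_top, Submodule.range_subtype] at this
    simpa [Function.comp_def] using this
  refine ⟨fun i => b i, fun j => f j, ⟨?_, hspan V b, ?_, hspan W f, ?_, ?_, ?_⟩⟩
  · exact b.orthonormal.comp_linearIsometry V.subtypeₗᵢ
  · exact f.orthonormal.comp_linearIsometry W.subtypeₗᵢ
  · intro i j hij
    rw [hS, hSf i ⟨i, i.isLt.trans_le hpq⟩ rfl, inner_smul_left,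
      orthonormal_iff_ite.mp f.orthonormal, if_neg (by simpa [Fin.ext_iff] using hij), mul_zero]
  · intro i j hij
    rw [hin i j hij]
    simp
  · intro i j hij
    rw [pairAngle, pairAngle, hin _ _ rfl, hin _ _ rfl, RCLike.ofReal_re, RCLike.ofReal_re]
    refine Real.arccos_le_arccos ?_
    refine (sq_le_sq₀ (norm_nonneg _) (norm_nonneg _)).mp ?_
    rw [hl, hl]
    -- Eigenvalues are listed in decreasing order, so the angles increase.
    exact hT.eigenvalues_antitone hV hij

/-- The cosine of the `i`-th principal angle, for families of `p` and `p + r` vectors. -/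
noncomputable def pairCos (𝕜 : Type*) {X : Type*} [RCLike 𝕜] [NormedAddCommGroup X]
    [InnerProductSpace 𝕜 X] {p r : ℕ} (e : Fin p → X) (f : Fin (p + r) → X) (i : Fin p) : ℝ :=
  RCLike.re ⟪e i, f (Fin.castAdd r i)⟫_𝕜

/-! ### Computations in principal bases -/

namespace IsPrincipalBases

variable {p r : ℕ} {V W : Submodule 𝕜 X} {e : Fin p → X} {f : Fin (p + r) → X}

theorem inner_castAdd (h : IsPrincipalBases V W e f) (i j : Fin p) :
    ⟪e i, f (Fin.castAdd r j)⟫_𝕜 = if i = j then (pairCos 𝕜 e f i : 𝕜) else 0 := by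
  split_ifs with hij
  · subst hij
    have := (h.inner_nonneg i (Fin.castAdd r i) rfl).2
    rw [pairCos]
    apply RCLike.ext <;> simp [this]
  · exact h.inner_eq_zero _ _ (by simpa [Fin.ext_iff] using hij)

theorem inner_natAdd (h : IsPrincipalBases V W e f) (i : Fin p) (j : Fin r) :
    ⟪e i, f (Fin.natAdd p j)⟫_𝕜 = 0 :=
  h.inner_eq_zero _ _ (by simp; omega)

theorem pairCos_nonneg (h : IsPrincipalBases V W e f) (i : Fin p) : 0 ≤ pairCos 𝕜 e f i :=
  (h.inner_nonneg i (Fin.castAdd r i) rfl).1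

theorem pairCos_le_one (h : IsPrincipalBases V W e f) (i : Fin p) : pairCos 𝕜 e f i ≤ 1 := by
  have := re_inner_le_norm (𝕜 := 𝕜) (e i) (f (Fin.castAdd r i))
  rwa [h.orthonormal_left.1, h.orthonormal_right.1, one_mul] at this

theorem prod_pairCos_nonneg (h : IsPrincipalBases V W e f) : 0 ≤ ∏ i, pairCos 𝕜 e f i :=
  Finset.prod_nonneg fun i _ => h.pairCos_nonneg i

theorem prod_pairCos_le_one (h : IsPrincipalBases V W e f) : ∏ i, pairCos 𝕜 e f i ≤ 1 :=
  Finset.prod_le_one (fun i _ => h.pairCos_nonneg i) fun i _ => h.pairCos_le_one i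

/-- For `x = ∑ a i • e i`, pairing with the `i`-th vector of `f` gives `conj (a i)` times the `i`-th
cosine. Nonzero cosines thus force `x = 0`, while a zero cosine makes `e i` itself orthogonal to
`W`. -/
theorem partiallyOrthogonal_iff (h : IsPrincipalBases V W e f) :
    PartiallyOrthogonal V W ↔ ∏ i, pairCos 𝕜 e f i = 0 := by
  rw [PartiallyOrthogonal, Finset.prod_eq_zero_iff]
  constructor
  · intro hVW
    by_contra! hc
    refine hVW ((Submodule.eq_bot_iff _).mpr fun x hx => ?_)
    obtain ⟨hxV, hxW⟩ := Submodule.mem_inf.mp hx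
    rw [← h.span_left] at hxV
    obtain ⟨a, rfl⟩ := (Submodule.mem_span_range_iff_exists_fun 𝕜).mp hxV
    refine Finset.sum_eq_zero fun i _ => ?_
    have hfi : f (Fin.castAdd r i) ∈ W := h.span_right ▸ Submodule.subset_span ⟨_, rfl⟩
    have h0 := (Submodule.mem_orthogonal' _ _).mp hxW _ hfi
    simp only [sum_inner, inner_smul_left, h.inner_castAdd, mul_ite, mul_zero,
      Finset.sum_ite_eq', Finset.mem_univ, if_true] at h0
    have hi : ((pairCos 𝕜 e f i : ℝ) : 𝕜) ≠ 0 := RCLike.ofReal_ne_zero.mpr (hc i (Finset.mem_univ i))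
    rw [(map_eq_zero _).mp ((mul_eq_zero.mp h0).resolve_right hi), zero_smul]
  · rintro ⟨i, -, hi⟩ hbot
    have hmem : e i ∈ V ⊓ Wᗮ := by
      refine ⟨h.span_left ▸ Submodule.subset_span ⟨_, rfl⟩, ?_⟩
      rw [SetLike.mem_coe, ← h.span_right, Submodule.mem_orthogonal']
      intro x hx
      obtain ⟨a, rfl⟩ := (Submodule.mem_span_range_iff_exists_fun 𝕜).mp hx
      rw [inner_sum, Fin.sum_univ_add]
      simp [inner_smul_right, h.inner_castAdd, h.inner_natAdd, hi]
    rw [hbot, Submodule.mem_bot] at hmem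
    exact h.orthonormal_left.ne_zero i hmem

/-- Pairing `e i` with `∑ a j • f j` gives `a i` times the `i`-th cosine, so orthogonality to `V`
kills exactly the first `p` coordinates. -/
theorem orthogonal_inf_eq_span (h : IsPrincipalBases V W e f)
    (h0 : ∏ i, pairCos 𝕜 e f i ≠ 0) :
    Vᗮ ⊓ W = Submodule.span 𝕜 (Set.range (f ∘ Fin.natAdd p)) := by
  have hV : ∀ x, x ∈ Vᗮ ↔ ∀ i, ⟪e i, x⟫_𝕜 = 0 := by
    intro x
    rw [← h.span_left, Submodule.mem_orthogonal]
    refine ⟨fun hx i => hx _ (Submodule.subset_span ⟨i, rfl⟩), fun hx y hy => ?_⟩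
    obtain ⟨a, rfl⟩ := (Submodule.mem_span_range_iff_exists_fun 𝕜).mp hy
    simp [sum_inner, inner_smul_left, hx]
  refine le_antisymm ?_ (Submodule.span_le.mpr ?_)
  · rintro x ⟨hxV, hxW⟩
    rw [SetLike.mem_coe, ← h.span_right] at hxW
    obtain ⟨a, rfl⟩ := (Submodule.mem_span_range_iff_exists_fun 𝕜).mp hxW
    have ha : ∀ i, a (Fin.castAdd r i) = 0 := by
      intro i
      have := (hV _).mp hxV i
      rw [inner_sum, Fin.sum_univ_add] at this
      simp only [inner_smul_right, h.inner_castAdd, h.inner_natAdd,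
        mul_ite, mul_zero, Finset.sum_ite_eq, Finset.mem_univ, if_true, Finset.sum_const_zero,
        add_zero] at this
      exact (mul_eq_zero.mp this).resolve_right
        (RCLike.ofReal_ne_zero.mpr (Finset.prod_ne_zero_iff.mp h0 i (Finset.mem_univ i)))
    rw [Fin.sum_univ_add]
    simp only [ha, zero_smul, Finset.sum_const_zero, zero_add]
    exact Submodule.sum_mem _ fun i _ => Submodule.smul_mem _ _ (Submodule.subset_span ⟨i, rfl⟩)
  · rintro _ ⟨j, rfl⟩
    exact ⟨(hV _).mpr fun i => h.inner_natAdd i j,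
      h.span_right ▸ Submodule.subset_span ⟨Fin.natAdd p j, rfl⟩⟩

theorem starProjection_apply [FiniteDimensional 𝕜 X] (h : IsPrincipalBases V W e f) (i : Fin p) :
    W.starProjection (e i) = (pairCos 𝕜 e f i : 𝕜) • f (Fin.castAdd r i) := by
  refine Submodule.eq_starProjection_of_mem_of_inner_eq_zero
    (Submodule.smul_mem _ _ (h.span_right ▸ Submodule.subset_span ⟨_, rfl⟩)) fun w hw => ?_
  rw [← h.span_right] at hw
  obtain ⟨a, rfl⟩ := (Submodule.mem_span_range_iff_exists_fun 𝕜).mp hw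
  rw [inner_sum]
  refine Finset.sum_eq_zero fun j _ => ?_
  rw [inner_smul_right, inner_sub_left, inner_smul_left, RCLike.conj_ofReal,
    orthonormal_iff_ite.mp h.orthonormal_right]
  refine mul_eq_zero_of_right _ ?_
  refine Fin.addCases (fun j => ?_) (fun j => ?_) j
  · rw [h.inner_castAdd]
    by_cases hij : i = j <;> simp [hij]
  · rw [h.inner_natAdd, if_neg (by simp [Fin.ext_iff]; omega)]
    simp

theorem mvProj_ιMulti [FiniteDimensional 𝕜 X] (h : IsPrincipalBases V W e f) :
    mvProj W (ιMulti 𝕜 p e) =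
      ((∏ i, pairCos 𝕜 e f i : ℝ) : 𝕜) • ιMulti 𝕜 p (f ∘ Fin.castAdd r) := by
  rw [mvProj, map_apply_ιMulti, RCLike.ofReal_prod, ← AlternatingMap.map_smul_univ]
  congr 1
  ext i
  exact h.starProjection_apply i

theorem leftContraction_ιMulti [FiniteDimensional 𝕜 X] (h : IsPrincipalBases V W e f) :
    leftContraction (ιMulti 𝕜 p e) (ιMulti 𝕜 (p + r) f) =
      ((∏ i, pairCos 𝕜 e f i : ℝ) : 𝕜) • ιMulti 𝕜 r (f ∘ Fin.natAdd p) := by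
  have hf : f = Fin.append (f ∘ Fin.castAdd r) (f ∘ Fin.natAdd p) :=
    (Fin.append_castAdd_natAdd).symm
  conv_lhs => rw [hf]
  rw [RCLike.ofReal_prod]
  exact Grassmann.leftContraction_ιMulti h.inner_castAdd h.inner_natAdd

theorem mvInner_ιMulti (h : IsPrincipalBases V W e f) :
    mvInner (ιMulti 𝕜 p e) (ιMulti 𝕜 p (f ∘ Fin.castAdd r)) =
      ((∏ i, pairCos 𝕜 e f i : ℝ) : 𝕜) := by
  have : (Matrix.of fun i j => ⟪e i, (f ∘ Fin.castAdd r) j⟫_𝕜) =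
      Matrix.diagonal fun i => (pairCos 𝕜 e f i : 𝕜) := by
    ext i j
    simp [h.inner_castAdd, Matrix.diagonal_apply]
  rw [Grassmann.mvInner_ιMulti, this, Matrix.det_diagonal, RCLike.ofReal_prod]

end IsPrincipalBases

end Grassmann

/-! ### The asymmetric angle and the characterization of the contraction -/

namespace Grassmann

open ExteriorAlgebra Module

variable {𝕜 X : Type*} [RCLike 𝕜] [NormedAddCommGroup X] [InnerProductSpace 𝕜 X]
  [FiniteDimensional 𝕜 X]

/-- If `V` meets `Wᗮ` trivially, their dimensions add up to at most `dim X = dim W + dim Wᗮ`. -/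
theorem le_of_not_partiallyOrthogonal {V W : Submodule 𝕜 X} (h : ¬ PartiallyOrthogonal V W) :
    finrank 𝕜 V ≤ finrank 𝕜 W := by
  have hVW : V ⊓ Wᗮ = ⊥ := not_not.mp h
  have h1 := Submodule.finrank_sup_add_finrank_inf_eq V Wᗮ
  have h2 := Submodule.finrank_add_finrank_orthogonal W
  have h3 := Submodule.finrank_le (V ⊔ Wᗮ)
  rw [hVW, finrank_bot] at h1
  omega

theorem leftContraction_smul_smul (c d : 𝕜) (M N : ExteriorAlgebra 𝕜 X) :
    leftContraction (c • M) (d • N) = (conj c * d) • leftContraction M N := by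
  symm
  refine eq_leftContraction fun r v => ?_
  rw [mvInner_smul_right, mvInner_leftContraction, smul_mul_assoc, mvInner_smul_left,
    mvInner_smul_right, mul_assoc]

theorem IsBlade.mvNorm_ne_zero {p : ℕ} {A : ExteriorAlgebra 𝕜 X} (hA : IsBlade p A)
    (hA0 : A ≠ 0) : mvNorm A ≠ 0 := by
  have hV := hA.finrank_bladeSpace hA0
  -- Principal bases of the space with itself serve only to supply an orthonormal basis.
  obtain ⟨e, _, h⟩ := exists_isPrincipalBases le_rfl hV hV
  obtain ⟨c, rfl⟩ := hA.exists_eq_smul_ιMulti hA0 h.orthonormal_left.linearIndependent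
    h.span_left.symm
  rw [mvNorm_smul, mvNorm_ιMulti_of_orthonormal h.orthonormal_left, mul_one]
  exact norm_ne_zero_iff.mpr (smul_ne_zero_iff.mp hA0).1

/-- A projective-orthogonal factorization of `B` with respect to `A` exists if the grade of `A` is
at most that of `B`. -/
theorem exists_isPOFactorization {p r : ℕ} {A B : ExteriorAlgebra 𝕜 X} (hA : IsBlade p A)
    (hA0 : A ≠ 0) (hB : IsBlade (p + r) B) (hB0 : B ≠ 0) : ∃ P Q, IsPOFactorization A B P Q := by
  obtain ⟨e, f, h⟩ := exists_isPrincipalBases (Nat.le_add_right p r)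
    (hA.finrank_bladeSpace hA0) (hB.finrank_bladeSpace hB0)
  obtain ⟨d, hd⟩ := hB.exists_eq_smul_ιMulti hB0 h.orthonormal_right.linearIndependent
    h.span_right.symm
  have hd0 : d ≠ 0 := by
    rintro rfl
    exact hB0 (by rw [hd, zero_smul])
  have hn : mvNorm B = ‖d‖ := by
    rw [hd, mvNorm_smul, mvNorm_ιMulti_of_orthonormal h.orthonormal_right, mul_one]
  have hnd : ‖d‖ ≠ 0 := norm_ne_zero_iff.mpr hd0
  -- The unit scalar is the phase of `d`, so that `ε ‖B‖ = d`.
  refine ⟨_, _, p, p + r, e, f, d / (‖d‖ : 𝕜), h, ?_, rfl, rfl, ?_⟩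
  · rw [norm_div, RCLike.norm_ofReal, abs_norm, div_self hnd]
  · rw [hn, div_mul_cancel₀ _ (RCLike.ofReal_ne_zero.mpr hnd), smul_mul_assoc, ιMulti_mul_ιMulti]
    conv_lhs => rw [hd, ← ιMulti_cast (by omega : min p (p + r) + (p + r - min p (p + r)) = p + r)]
    congr 2
    ext i
    refine Fin.addCases (fun j => ?_) (fun j => ?_) i
    · rw [Fin.append_left]
      rfl
    · rw [Fin.append_right]
      rfl

/-- Both sides equal `‖c‖ ‖d‖ κ`. The computation works for whichever factorization the angle
selects, hence does not depend on that choice. -/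
theorem mvNorm_mul_cos_asymmetricAngle {p r : ℕ} {A B : ExteriorAlgebra 𝕜 X} (hA : IsBlade p A)
    (hA0 : A ≠ 0) (hB : IsBlade (p + r) B) (hB0 : B ≠ 0) :
    mvNorm A * mvNorm B * Real.cos (asymmetricAngle A B) =
      mvNorm (mvProj (bladeSpace B) A) * mvNorm B := by
  have hex := exists_isPOFactorization hA hA0 hB hB0
  rw [asymmetricAngle, dif_pos hex]
  obtain ⟨Q, m, n, e, f, ε, h, hε, hP, -, -⟩ := hex.choose_spec
  generalize hex.choose = P at hP
  obtain rfl : m = p := by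
    rw [← hA.finrank_bladeSpace hA0, ← h.span_left,
      finrank_span_eq_card h.orthonormal_left.linearIndependent, Fintype.card_fin]
  obtain rfl : n = m + r := by
    rw [← hB.finrank_bladeSpace hB0, ← h.span_right,
      finrank_span_eq_card h.orthonormal_right.linearIndependent, Fintype.card_fin]
  replace hP : P = (ε * (mvNorm B : 𝕜)) • ιMulti 𝕜 m (f ∘ Fin.castAdd r) := by
    rw [hP, ← ιMulti_cast (min_eq_left (Nat.le_add_right m r))]
    rfl
  obtain ⟨c, hc⟩ := hA.exists_eq_smul_ιMulti hA0 h.orthonormal_left.linearIndependent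
    h.span_left.symm
  obtain ⟨d, hd⟩ := hB.exists_eq_smul_ιMulti hB0 h.orthonormal_right.linearIndependent
    h.span_right.symm
  have hc0 : ‖c‖ ≠ 0 := by
    rw [norm_ne_zero_iff]
    rintro rfl
    exact hA0 (by rw [hc, zero_smul])
  have hd0 : ‖d‖ ≠ 0 := by
    rw [norm_ne_zero_iff]
    rintro rfl
    exact hB0 (by rw [hd, zero_smul])
  have hnA : mvNorm A = ‖c‖ := by
    rw [hc, mvNorm_smul, mvNorm_ιMulti_of_orthonormal h.orthonormal_left, mul_one]
  have hnB : mvNorm B = ‖d‖ := by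
    rw [hd, mvNorm_smul, mvNorm_ιMulti_of_orthonormal h.orthonormal_right, mul_one]
  have hproj : mvNorm (mvProj (bladeSpace B) A) = ‖c‖ * ∏ i, pairCos 𝕜 e f i := by
    rw [hc, map_smul, h.mvProj_ιMulti, mvNorm_smul, mvNorm_smul, mvNorm_ιMulti_of_orthonormal
      (h.orthonormal_right.comp _ (Fin.castAdd_injective m r)), RCLike.norm_ofReal,
      abs_of_nonneg h.prod_pairCos_nonneg, mul_one]
  have hin : ‖mvInner A P‖ / (mvNorm A * mvNorm B) = ∏ i, pairCos 𝕜 e f i := by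
    have : ‖mvInner A P‖ = ‖c‖ * (‖d‖ * ∏ i, pairCos 𝕜 e f i) := by
      rw [hP, hnB, hc, mvInner_smul_left, mvInner_smul_right, h.mvInner_ιMulti, norm_mul,
        norm_mul, norm_mul, hε, RCLike.norm_conj, RCLike.norm_ofReal, RCLike.norm_ofReal,
        abs_norm, abs_of_nonneg h.prod_pairCos_nonneg, one_mul]
    rw [this, hnA, hnB]
    field_simp
  -- The product of cosines lies in `[0, 1]`, so `cos` undoes `arccos`.
  rw [hin, Real.cos_arccos (by linarith [h.prod_pairCos_nonneg]) h.prod_pairCos_le_one, hproj,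
    hnA, hnB]
  ring

theorem partiallyOrthogonal_iff_leftContraction_eq_zero {p q : ℕ} {A B : ExteriorAlgebra 𝕜 X}
    (hA : IsBlade p A) (hA0 : A ≠ 0) (hB : IsBlade q B) (hB0 : B ≠ 0) :
    PartiallyOrthogonal (bladeSpace A) (bladeSpace B) ↔ leftContraction A B = 0 := by
  rcases lt_or_ge q p with hpq | hpq
  · refine iff_of_true ?_ (leftContraction_eq_zero_of_lt hpq hA hB)
    by_contra h
    have := le_of_not_partiallyOrthogonal h
    rw [hA.finrank_bladeSpace hA0, hB.finrank_bladeSpace hB0] at this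
    omega
  · obtain ⟨r, rfl⟩ := Nat.exists_eq_add_of_le hpq
    obtain ⟨e, f, h⟩ := exists_isPrincipalBases hpq
      (hA.finrank_bladeSpace hA0) (hB.finrank_bladeSpace hB0)
    obtain ⟨c, hc⟩ := hA.exists_eq_smul_ιMulti hA0 h.orthonormal_left.linearIndependent
      h.span_left.symm
    obtain ⟨d, hd⟩ := hB.exists_eq_smul_ιMulti hB0 h.orthonormal_right.linearIndependent
      h.span_right.symm
    have hc0 : c ≠ 0 := by
      rintro rfl
      exact hA0 (by rw [hc, zero_smul])
    have hd0 : d ≠ 0 := by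
      rintro rfl
      exact hB0 (by rw [hd, zero_smul])
    have hH : ιMulti 𝕜 r (f ∘ Fin.natAdd p) ≠ 0 := ιMulti_ne_zero_of_orthonormal
      (h.orthonormal_right.comp _ (Fin.natAdd_injective r p))
    rw [h.partiallyOrthogonal_iff]
    conv_rhs => rw [hc, hd]
    rw [leftContraction_smul_smul, h.leftContraction_ιMulti]
    simp only [smul_eq_zero, mul_eq_zero, map_eq_zero, hc0, hd0, hH, or_false, false_or]

/-- The left contraction of blades that are not partially orthogonal has the space, norm and
orientation that characterize it. -/
theorem leftContraction_spec {p r : ℕ} {A B : ExteriorAlgebra 𝕜 X} (hA : IsBlade p A)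
    (hA0 : A ≠ 0) (hB : IsBlade (p + r) B) (hB0 : B ≠ 0)
    (hAB : ¬ PartiallyOrthogonal (bladeSpace A) (bladeSpace B)) :
    IsBlade r (leftContraction A B) ∧
      bladeSpace (leftContraction A B) = (bladeSpace A)ᗮ ⊓ bladeSpace B ∧
      mvNorm (leftContraction A B) = mvNorm (mvProj (bladeSpace B) A) * mvNorm B ∧
      SameOrientation (mvProj (bladeSpace B) A * leftContraction A B) B := by
  have hne := mt (partiallyOrthogonal_iff_leftContraction_eq_zero hA hA0 hB hB0).mpr hAB
  obtain ⟨e, f, h⟩ := exists_isPrincipalBases (Nat.le_add_right p r)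
    (hA.finrank_bladeSpace hA0) (hB.finrank_bladeSpace hB0)
  obtain ⟨c, hc⟩ := hA.exists_eq_smul_ιMulti hA0 h.orthonormal_left.linearIndependent
    h.span_left.symm
  obtain ⟨d, hd⟩ := hB.exists_eq_smul_ιMulti hB0 h.orthonormal_right.linearIndependent
    h.span_right.symm
  have hκ : ∏ i, pairCos 𝕜 e f i ≠ 0 := fun h0 => hAB (h.partiallyOrthogonal_iff.mpr h0)
  have hc0 : 0 < ‖c‖ := by
    rw [norm_pos_iff]
    rintro rfl
    exact hA0 (by rw [hc, zero_smul])
  have hκpos := lt_of_le_of_ne h.prod_pairCos_nonneg hκ.symm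
  have hproj : mvProj (bladeSpace B) A = (c * ((∏ i, pairCos 𝕜 e f i : ℝ) : 𝕜)) •
      ιMulti 𝕜 p (f ∘ Fin.castAdd r) := by
    conv_lhs => rw [hc, map_smul, h.mvProj_ιMulti, smul_smul]
  have hG : leftContraction A B = (conj c * d * ((∏ i, pairCos 𝕜 e f i : ℝ) : 𝕜)) •
      ιMulti 𝕜 r (f ∘ Fin.natAdd p) := by
    conv_lhs => rw [hc, hd]
    rw [leftContraction_smul_smul, h.leftContraction_ιMulti, smul_smul]
  have hnorm := mvNorm_ιMulti_of_orthonormal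
    (h.orthonormal_right.comp _ (Fin.natAdd_injective r p))
  have hnorm' := mvNorm_ιMulti_of_orthonormal
    (h.orthonormal_right.comp _ (Fin.castAdd_injective p r))
  refine ⟨⟨_, _, hG⟩, ?_, ?_, ?_⟩
  · rw [h.orthogonal_inf_eq_span hκ, hG, bladeSpace_eq_span (hG ▸ hne)]
  · have hnB : mvNorm B = ‖d‖ := by
      rw [hd, mvNorm_smul, mvNorm_ιMulti_of_orthonormal h.orthonormal_right, mul_one]
    rw [hproj, hG, mvNorm_smul, mvNorm_smul, hnorm, hnorm', hnB]
    simp only [norm_mul, RCLike.norm_conj]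
    ring
  -- The projection contributes `c κ` and the contraction `conj c d κ`: conjugate linearity turns
  -- the phase of `c` into the positive factor `‖c‖ ^ 2`.
  · refine ⟨‖c‖ ^ 2 * (∏ i, pairCos 𝕜 e f i) ^ 2, by positivity, ?_⟩
    have hf : Fin.append (f ∘ Fin.castAdd r) (f ∘ Fin.natAdd p) = f := Fin.append_castAdd_natAdd
    rw [hproj, hG, smul_mul_smul_comm, ιMulti_mul_ιMulti, hf]
    conv_rhs => rw [hd, smul_smul]
    congr 1
    push_cast
    rw [← RCLike.mul_conj c]
    ring

/-- A blade with the space, norm and orientation of the left contraction is the contraction. -/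
theorem eq_leftContraction_of_bladeSpace_eq {p r : ℕ} {A B C : ExteriorAlgebra 𝕜 X}
    (hA : IsBlade p A) (hA0 : A ≠ 0) (hB : IsBlade (p + r) B) (hB0 : B ≠ 0)
    (hAB : ¬ PartiallyOrthogonal (bladeSpace A) (bladeSpace B)) (hC : IsBlade r C)
    (hCs : bladeSpace C = (bladeSpace A)ᗮ ⊓ bladeSpace B)
    (hCn : mvNorm C = mvNorm (mvProj (bladeSpace B) A) * mvNorm B)
    (hCo : SameOrientation (mvProj (bladeSpace B) A * C) B) : C = leftContraction A B := by
  have hne := mt (partiallyOrthogonal_iff_leftContraction_eq_zero hA hA0 hB hB0).mpr hAB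
  obtain ⟨hG, hGs, hGn, l, hl, hGo⟩ := leftContraction_spec hA hA0 hB hB0 hAB
  obtain ⟨k, hk, hCo⟩ := hCo
  have hC0 : C ≠ 0 := by
    rintro rfl
    rw [mul_zero] at hCo
    exact smul_ne_zero (RCLike.ofReal_ne_zero.mpr hk.ne') hB0 hCo.symm
  generalize leftContraction A B = G at *
  obtain ⟨a, v, rfl⟩ := hC
  have hv := smul_ne_zero_iff.mp hC0
  have hvG : bladeSpace G = Submodule.span 𝕜 (Set.range v) := by
    rw [hGs, ← hCs, bladeSpace_eq_span hC0]
  obtain ⟨b, hb⟩ := hG.exists_eq_smul_ιMulti hne (linearIndependent_of_ιMulti_ne_zero hv.2) hvG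
  have hb0 : b ≠ 0 := by
    rintro rfl
    exact hne (by rw [hb, zero_smul])
  -- The candidate is `a` and the contraction `b` times the same wedge product. Comparing their two
  -- orientation conditions yields this relation; equal norms then give `l = k`, hence `a = b`.
  have hab : a * l = k * b := by
    have h1 : b • (a • (mvProj (bladeSpace B) A * ιMulti 𝕜 r v)) = (b * k) • B := by
      rw [← mul_smul_comm, hCo, smul_smul]
    have h2 : a • (b • (mvProj (bladeSpace B) A * ιMulti 𝕜 r v)) = (a * l) • B := by
      rw [← mul_smul_comm, ← hb, hGo, smul_smul]
    rw [smul_comm, h2] at h1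
    rw [smul_left_injective 𝕜 hB0 h1, mul_comm]
  have hn0 : mvNorm (ιMulti 𝕜 r v) ≠ 0 :=
    IsBlade.mvNorm_ne_zero ⟨1, v, (one_smul _ _).symm⟩ hv.2
  have hnab : ‖a‖ = ‖b‖ := by
    rw [← hGn, hb, mvNorm_smul, mvNorm_smul] at hCn
    exact mul_right_cancel₀ hn0 hCn
  have hkl : l = k := by
    have := congrArg norm hab
    rw [norm_mul, norm_mul, RCLike.norm_ofReal, RCLike.norm_ofReal, abs_of_pos hl, abs_of_pos hk,
      hnab, mul_comm] at this
    exact mul_right_cancel₀ (norm_ne_zero_iff.mpr hb0) this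
  rw [hkl, mul_comm] at hab
  rw [hb, mul_left_cancel₀ (RCLike.ofReal_ne_zero.mpr hk.ne') hab]

end Grassmann

/-! ### The main theorem -/

theorem mainTheorem2 {𝕜 X : Type*} [RCLike 𝕜] [NormedAddCommGroup X] [InnerProductSpace 𝕜 X]
    [FiniteDimensional 𝕜 X] (p q : ℕ) (A B : ExteriorAlgebra 𝕜 X)
    (hA : IsBlade p A) (hA0 : A ≠ 0) (hB : IsBlade q B) (hB0 : B ≠ 0) :
    (PartiallyOrthogonal (bladeSpace A) (bladeSpace B) ↔
      leftContraction A B = 0 ∧ rightContraction B A = 0) ∧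
    (¬ PartiallyOrthogonal (bladeSpace A) (bladeSpace B) →
      p ≤ q ∧
      mvNorm A * mvNorm B * Real.cos (asymmetricAngle A B) =
        mvNorm (mvProj (bladeSpace B) A) * mvNorm B ∧
      (∀ C : ExteriorAlgebra 𝕜 X,
        (IsBlade (q - p) C ∧
          bladeSpace C = (bladeSpace A)ᗮ ⊓ bladeSpace B ∧
          mvNorm C = mvNorm A * mvNorm B * Real.cos (asymmetricAngle A B) ∧
          SameOrientation (mvProj (bladeSpace B) A * C) B) ↔
        C = leftContraction A B) ∧
      (∀ C : ExteriorAlgebra 𝕜 X,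
        (IsBlade (q - p) C ∧
          bladeSpace C = (bladeSpace A)ᗮ ⊓ bladeSpace B ∧
          mvNorm C = mvNorm A * mvNorm B * Real.cos (asymmetricAngle A B) ∧
          SameOrientation (C * mvProj (bladeSpace B) A) B) ↔
        C = rightContraction B A)) := by
  have hAB := partiallyOrthogonal_iff_leftContraction_eq_zero hA hA0 hB hB0
  have hR := rightContraction_eq_smul_leftContraction hA hB
  refine ⟨⟨fun h => ?_, fun h => hAB.mpr h.1⟩, fun h => ?_⟩
  · rw [hR, hAB.mp h, smul_zero]
    exact ⟨rfl, rfl⟩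
  have hpq : p ≤ q := by
    have := le_of_not_partiallyOrthogonal h
    rwa [hA.finrank_bladeSpace hA0, hB.finrank_bladeSpace hB0] at this
  obtain ⟨r, rfl⟩ := Nat.exists_eq_add_of_le hpq
  have hcos := mvNorm_mul_cos_asymmetricAngle hA hA0 hB hB0
  have hne := mt hAB.mpr h
  obtain ⟨hG, hGs, hGn, hGo⟩ := leftContraction_spec hA hA0 hB hB0 h
  have hPA : IsBlade p (mvProj (bladeSpace B) A) := by
    obtain ⟨c, v, rfl⟩ := hA
    exact ⟨c, _, by rw [map_smul, mvProj, ExteriorAlgebra.map_apply_ιMulti]⟩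
  rw [Nat.add_sub_cancel_left] at hR ⊢
  have hs : (-1 : 𝕜) ^ (p * r) * (-1) ^ (p * r) = 1 := by
    rw [← mul_pow]; simp
  have hs0 : (-1 : 𝕜) ^ (p * r) ≠ 0 := left_ne_zero_of_mul_eq_one hs
  have hs1 : ‖(-1 : 𝕜) ^ (p * r)‖ = 1 := by simp
  -- Multiplying `C` by the sign turns (iii') into (iii) without changing its space or norm, which
  -- reduces the right contraction to the left one.
  have hcomm : ∀ C, IsBlade r C → mvProj (bladeSpace B) A * ((-1 : 𝕜) ^ (p * r) • C) =
      C * mvProj (bladeSpace B) A := by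
    intro C hC
    rw [mul_smul_comm, hPA.mul_comm hC, smul_smul, hs, one_smul]
  rw [hcos]
  refine ⟨hpq, rfl, fun C => ⟨?_, ?_⟩, fun C => ⟨?_, ?_⟩⟩
  · rintro ⟨hC, hCs, hCn, hCo⟩
    exact eq_leftContraction_of_bladeSpace_eq hA hA0 hB hB0 h hC hCs hCn hCo
  · rintro rfl
    exact ⟨hG, hGs, hGn, hGo⟩
  · rintro ⟨hC, hCs, hCn, hCo⟩
    have hC0 : C ≠ 0 := by
      rintro rfl
      obtain ⟨k, hk, hCo⟩ := hCo
      rw [zero_mul] at hCo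
      exact smul_ne_zero (RCLike.ofReal_ne_zero.mpr hk.ne') hB0 hCo.symm
    rw [hR, ← eq_leftContraction_of_bladeSpace_eq hA hA0 hB hB0 h (hC.smul _)
      ((bladeSpace_smul hC hC0 hs0).trans hCs) (by rw [mvNorm_smul, hs1, one_mul, hCn])
      ((hcomm C hC).symm ▸ hCo), smul_smul, hs, one_smul]
  · rintro rfl
    rw [hR]
    refine ⟨hG.smul _, (bladeSpace_smul hG hne hs0).trans hGs,
      by rw [mvNorm_smul, hs1, one_mul, hGn], ?_⟩
    rwa [← hcomm _ (hG.smul _), smul_smul, hs, one_smul]
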